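/- For a graph $G$, a family $\mathcal F$ of graphs containing the single edge $K_2$, and an integer $n\ge |V(G)|$, let $f(n,G\,|\,\mathcal F)$ be the smallest positive integer $m$ such that every edge coloring of the complete graph $K_n$ in which at least $m$ colors occur contains a copy of $G$ all of whose color classes (the graphs formed by the edges of the copy having a common color) are members of $\mathcal F$. Let $\mathrm{ex}(n,H)$ be the maximum number of edges of a graph on $n$ vertices that has no subgraph isomorphic to $H$, and let $\mathcal F_{\mathrm{sq}}$ be the family of all graphs whose number of edges is $k^2$ for some integer $k\ge 1$. Theorem. For every integer $p\ge 5$, $$f(n,K_p\,|\,\mathcal F_{\mathrm{sq}})=(1+o(1))\,\mathrm{ex}\bigl(n,K_{\lceil p/2\rceil}\bigr)\qquad (n\to\infty),$$ and moreover, for every $n\ge p$, $$f(n,K_p\,|\,\mathcal F_{\mathrm{sq}})\ \ge\ \mathrm{ex}\bigl(n,K_{\lceil p/2\rceil}\bigr)+n-\lceil p/2\rceil+2 .$$ -/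

import Mathlib

namespace RainbowF

/-- A family of graphs: a property of simple graphs on arbitrary vertex types. -/
abbrev GraphFamily : Type 1 := ∀ V : Type, SimpleGraph V → Prop

/-- The graph formed by the edges of `H`: isolated vertices are removed. -/
abbrev edgeInduced {V : Type} (H : SimpleGraph V) : SimpleGraph H.support :=
  H.induce H.support

/-- The number of colors that actually occur in an edge coloring. -/
noncomputable def numColors {V : Type} {G : SimpleGraph V} (C : G.EdgeLabeling ℕ) : ℕ :=
  {k : ℕ | ∃ e : G.edgeSet, C e = k}.ncard

/-- Every (nonempty) color class of the edge coloring `C` of `G` induces a member of `F`. -/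
def AllClassesIn (F : GraphFamily) {V : Type} {G : SimpleGraph V}
    (C : G.EdgeLabeling ℕ) : Prop :=
  ∀ e : G.edgeSet, F _ (edgeInduced (C.labelGraph (C e)))

/-- `f(n, G | F)`: the smallest positive integer `m` such that every edge coloring of `K_n` with at
least `m` colors contains a copy of `G` all of whose color classes (the restrictions of the color
classes of `K_n` to the edges of the copy) are members of `F`. -/
noncomputable def f (n : ℕ) {V : Type} (G : SimpleGraph V) (F : GraphFamily) : ℕ :=
  sInf {m : ℕ | 1 ≤ m ∧ ∀ C : (⊤ : SimpleGraph (Fin n)).EdgeLabeling ℕ, m ≤ numColors C →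
    ∃ φ : G.Copy (⊤ : SimpleGraph (Fin n)), AllClassesIn F (C.pullback φ.toHom)}

/-- The family of all graphs whose number of edges is `k ^ 2` for some `k ≥ 1`. -/
def squareFamily : GraphFamily :=
  fun _ H => ∃ k : ℕ, 1 ≤ k ∧ H.edgeSet.ncard = k ^ 2

/-- The complete graph `K_p`. -/
abbrev K (p : ℕ) : SimpleGraph (Fin p) := ⊤

end RainbowF

open Finset RainbowF

/-! Put q = ⌈p/2⌉, so that p = 2q or p = 2q - 1, with q ≥ 3.

Upper bound: choose one edge of each colour. If slightly more than the Turán number of colours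
occur, Erdős–Stone puts a complete q-partite graph with large parts inside this rainbow graph. The
edges inside a part are uncontrolled, but by Ramsey each part holds many disjoint monochromatic
blocks: edges of distinct colours, or cliques of order p in one colour (`exists_isBlockSystem`). A
counting argument (`exists_conflict_free`) selects one block per part so that no cross edge at the
selected blocks has a block colour and the colour of a single-edge block is not shared. A cross
colour then occurs at most once, and 1 is a square. It remains to choose how many vertices to take
from each block, p in all, so that every block colour covers a square number of edges; this is pure
arithmetic (`exists_part_sizes`). `exists_square_clique` combines these steps.

Lower bound: make the Turán graph with r = q - 1 parts rainbow and give every other edge a new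
colour, indexed by its smaller end. Since p > 2r, a copy of K_p has three vertices in some part, and
the third largest of its vertices there is the colour of exactly two edges; 2 is not a square. -/

/-! ### Arithmetic: block sizes with square edge totals -/

/-- The vertex counts `t` that can be split over `m` monochromatic parts of a common colour so that
the total number of inner edges is a square (using at most two vertices if `m = 1`). -/
def SquareSplit (m t : ℕ) : Prop :=
  ∃ M : Multiset ℕ, M.card = m ∧ M.sum = t ∧ IsSquare (M.map (fun x => x.choose 2)).sum ∧
    (m = 1 → ∀ x ∈ M, x ≤ 2)

/-- Start with all parts of size 2, which gives s edges. Replacing a pair 2, 2 by 3, 1 keeps the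
vertex count and gains one edge, so every total from s to 3s/2 is attainable. -/
lemma squareSplit_two_mul_of_add_eq {s j k : ℕ} (hj : 2 * j ≤ s) (hk : s + j = k * k)
    (hs : 3 ≤ s) : SquareSplit s (2 * s) := by
  refine ⟨Multiset.replicate j 3 + Multiset.replicate j 1 + Multiset.replicate (s - 2 * j) 2,
    ?_, ?_, ⟨k, ?_⟩, by omega⟩
  · simp; omega
  · simp; omega
  · simp [Multiset.map_replicate]
    omega

lemma squareSplit_two_mul {s : ℕ} (hs : 3 ≤ s) : SquareSplit s (2 * s) := by
  rcases le_or_gt 17 s with h | h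
  · have h1 := Nat.sqrt_le (s - 1)
    have h3 := Nat.lt_succ_sqrt (s - 1)
    have h4 : 4 ≤ Nat.sqrt (s - 1) := Nat.le_sqrt.2 (by omega)
    set r := Nat.sqrt (s - 1)
    obtain ⟨u, rfl⟩ : ∃ u, s = u + 1 := ⟨s - 1, by omega⟩
    simp only [Nat.add_sub_cancel, Nat.succ_eq_add_one] at h1 h3
    -- The least square that is at least s; it is at most 3s/2 as soon as r² - 4r + 1 ≥ 0, that is,
    -- r ≥ 4, whence the threshold 17.
    refine squareSplit_two_mul_of_add_eq (j := (r + 1) * (r + 1) - (u + 1)) (k := r + 1)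
      ?_ (by omega) hs
    have : 2 * ((r + 1) * (r + 1)) ≤ 3 * (u + 1) := by nlinarith
    omega
  · have key (j k : ℕ) (hj : 2 * j ≤ s) (hk : s + j = k * k) :=
      squareSplit_two_mul_of_add_eq hj hk hs
    interval_cases s
    · exact key 1 2 (by norm_num) (by norm_num)
    · exact key 0 2 (by norm_num) (by norm_num)
    -- No square lies between s and 3s/2 for s = 5 or s = 10, so these two cases need other splits.
    · exact ⟨{3, 3, 3, 1, 0}, rfl, rfl, ⟨3, rfl⟩, by omega⟩
    · exact key 3 3 (by norm_num) (by norm_num)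
    · exact key 2 3 (by norm_num) (by norm_num)
    · exact key 1 3 (by norm_num) (by norm_num)
    · exact key 0 3 (by norm_num) (by norm_num)
    · exact ⟨{4, 3, 3, 3, 2, 1, 1, 1, 1, 1}, rfl, rfl, ⟨4, rfl⟩, by omega⟩
    · exact key 5 4 (by norm_num) (by norm_num)
    · exact key 4 4 (by norm_num) (by norm_num)
    · exact key 3 4 (by norm_num) (by norm_num)
    · exact key 2 4 (by norm_num) (by norm_num)
    · exact key 1 4 (by norm_num) (by norm_num)
    · exact key 0 4 (by norm_num) (by norm_num)

lemma squareSplit_two_mul_sub_one {s : ℕ} (hs : 3 ≤ s) : SquareSplit s (2 * s - 1) := by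
  rcases hs.eq_or_lt with rfl | h
  · exact ⟨{3, 2, 0}, rfl, rfl, ⟨2, rfl⟩, by omega⟩
  · obtain ⟨M, h1, h2, h3, -⟩ := squareSplit_two_mul (s := s - 1) (by omega)
    refine ⟨1 ::ₘ M, ?_, ?_, ?_, by omega⟩
    · simp; omega
    · simp; omega
    · simpa using h3

lemma squareSplit_one {t : ℕ} (ht : t ≤ 2) : SquareSplit 1 t := by
  refine ⟨{t}, rfl, by simp, ?_, by simpa⟩
  interval_cases t
  · exact ⟨0, rfl⟩
  · exact ⟨0, rfl⟩
  · exact ⟨1, rfl⟩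

/-- Two parts cannot carry 4 vertices: the edge totals would be 2, 3 or 6. This is the exceptional
case in `distributes_or`. -/
lemma squareSplit_two : SquareSplit 2 2 ∧ SquareSplit 2 3 ∧ SquareSplit 2 5 :=
  ⟨⟨{1, 1}, rfl, rfl, ⟨0, rfl⟩, by omega⟩, ⟨{2, 1}, rfl, rfl, ⟨1, rfl⟩, by omega⟩,
    ⟨{3, 2}, rfl, rfl, ⟨2, rfl⟩, by omega⟩⟩

/-- `n` vertices can be distributed over the colours in `A`, where colour `k` is the colour of `m k`
parts. -/
def Distributes (m : ℕ → ℕ) (A : Finset ℕ) (n : ℕ) : Prop :=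
  ∃ t : ℕ → ℕ, (∀ k ∈ A, SquareSplit (m k) (t k)) ∧ ∑ k ∈ A, t k = n

lemma Distributes.insert {m : ℕ → ℕ} {A : Finset ℕ} {n n' t k : ℕ} (h : Distributes m A n)
    (hk : k ∉ A) (ht : SquareSplit (m k) t) (hn : n + t = n') :
    Distributes m (insert k A) n' := by
  obtain ⟨u, hu, hs⟩ := h
  refine ⟨Function.update u k t, ?_, ?_⟩
  · intro l hl
    rcases eq_or_ne l k with rfl | hlk
    · simpa
    · simpa [hlk] using hu l (by simpa [hlk] using hl)
  · rw [sum_insert hk, Function.update_self, sum_update_of_notMem hk]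
    omega

/-- Colours are added one at a time. A lone colour with two parts misses the total 4, but its totals
2, 3 and 5 are off by small amounts that any further colour can compensate, so the exception
disappears once there are three parts. -/
lemma distributes_or (m : ℕ → ℕ) (A : Finset ℕ) (hA : A.Nonempty) (hm : ∀ k ∈ A, 1 ≤ m k) :
    (Distributes m A (2 * ∑ k ∈ A, m k) ∧ Distributes m A (2 * ∑ k ∈ A, m k - 1)) ∨
    (∑ k ∈ A, m k = 2 ∧ Distributes m A 2 ∧ Distributes m A 3 ∧ Distributes m A 5) := by
  induction A using Finset.induction_on with
  | empty => simp at hA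
  | insert k A hk ih =>
    rw [sum_insert hk]
    have hmk := hm k (mem_insert_self _ _)
    have h0 : Distributes m ∅ 0 := ⟨0, by simp, by simp⟩
    have h2 := squareSplit_two
    rcases A.eq_empty_or_nonempty with rfl | hne
    · rw [sum_empty]
      have key (t : ℕ) (ht : SquareSplit (m k) t) := h0.insert hk ht (Nat.zero_add t)
      rcases (by omega : m k = 1 ∨ m k = 2 ∨ 3 ≤ m k) with h | h | h
      · rw [h] at key ⊢
        exact .inl ⟨key _ (squareSplit_one (by simp)), key _ (squareSplit_one (by simp))⟩
      · rw [h] at key ⊢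
        exact .inr ⟨rfl, key _ h2.1, key _ h2.2.1, key _ h2.2.2⟩
      · exact .inl ⟨key _ (squareSplit_two_mul h), key _ (squareSplit_two_mul_sub_one h)⟩
    · have hA1 : 1 ≤ ∑ k ∈ A, m k := by
        obtain ⟨x, hx⟩ := hne
        exact (hm x (mem_insert_of_mem hx)).trans (single_le_sum (fun _ _ => Nat.zero_le _) hx)
      refine .inl ?_
      generalize ∑ k ∈ A, m k = σ at *
      rcases ih hne (fun l hl => hm l (mem_insert_of_mem hl)) with ⟨e, o⟩ | ⟨hσ, e2, e3, e5⟩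
      · rcases (by omega : m k = 1 ∨ m k = 2 ∨ 3 ≤ m k) with h | h | h
        · rw [h]
          exact ⟨e.insert hk (t := 2) (h ▸ squareSplit_one le_rfl) (by omega),
            e.insert hk (t := 1) (h ▸ squareSplit_one one_le_two) (by omega)⟩
        · rw [h]
          exact ⟨o.insert hk (h ▸ h2.2.2) (by omega), e.insert hk (h ▸ h2.2.1) (by omega)⟩
        · exact ⟨e.insert hk (squareSplit_two_mul h) (by omega),
            e.insert hk (squareSplit_two_mul_sub_one h) (by omega)⟩
      · rcases (by omega : m k = 1 ∨ m k = 2 ∨ 3 ≤ m k) with h | h | h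
        · rw [h]
          exact ⟨e5.insert hk (t := 1) (h ▸ squareSplit_one one_le_two) (by omega),
            e5.insert hk (t := 0) (h ▸ squareSplit_one zero_le_two) (by omega)⟩
        · rw [h]
          exact ⟨e5.insert hk (h ▸ h2.2.1) (by omega), e5.insert hk (h ▸ h2.1) (by omega)⟩
        · exact ⟨e5.insert hk (squareSplit_two_mul_sub_one h) (by omega),
            e3.insert hk (squareSplit_two_mul h) (by omega)⟩

lemma exists_map_eq_of_card_eq {ι : Type} [DecidableEq ι] (s : Finset ι) (M : Multiset ℕ)
    (h : M.card = #s) : ∃ a : ι → ℕ, s.val.map a = M := by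
  induction s using Finset.induction_on generalizing M with
  | empty => exact ⟨0, by simpa [eq_comm] using h⟩
  | insert i s hi ih =>
    rw [card_insert_of_notMem hi] at h
    obtain ⟨x, N, rfl⟩ := Multiset.card_pos_iff_exists_mem.1 (by omega : 0 < M.card) |>.imp
      fun x hx => Multiset.exists_cons_of_mem hx
    obtain ⟨a, ha⟩ := ih N (by simpa using h)
    refine ⟨Function.update a i x, ?_⟩
    rw [insert_val_of_notMem hi, Multiset.map_cons, Function.update_self, ← ha]
    congr 1
    exact Multiset.map_congr rfl fun j hj => Function.update_of_ne (by rintro rfl; exact hi hj) _ _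

/-- Sizes of the vertex sets chosen from monochromatic parts with colours `κ`. -/
theorem exists_part_sizes {ι : Type} [Fintype ι] [DecidableEq ι] (κ : ι → ℕ) (p : ℕ)
    (hι : 3 ≤ Fintype.card ι) (hp : p = 2 * Fintype.card ι ∨ p = 2 * Fintype.card ι - 1) :
    ∃ a : ι → ℕ, ∑ i, a i = p ∧ (∀ k, IsSquare (∑ i with κ i = k, (a i).choose 2)) ∧
      ∀ i, (∀ j, κ j = κ i → j = i) → a i ≤ 2 := by
  set m : ℕ → ℕ := fun k => #{i | κ i = k} with hm
  have hsum : ∑ k ∈ univ.image κ, m k = Fintype.card ι :=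
    (card_eq_sum_card_image κ univ).symm
  have hne : (univ : Finset ι).Nonempty := by
    rw [← card_pos, card_univ]; omega
  have hd : Distributes m (univ.image κ) p := by
    have := distributes_or m (univ.image κ) (hne.image κ) (by
      intro k hk
      obtain ⟨i, -, rfl⟩ := mem_image.1 hk
      exact card_pos.2 ⟨i, by simp⟩)
    rw [hsum] at this
    rcases this with ⟨h1, h2⟩ | h
    · rcases hp with rfl | rfl <;> assumption
    · omega
  obtain ⟨t, ht, hts⟩ := hd
  have (k : ℕ) : ∃ a : ι → ℕ, k ∈ univ.image κ →
      ∑ i with κ i = k, a i = t k ∧ IsSquare (∑ i with κ i = k, (a i).choose 2) ∧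
      (m k = 1 → ∀ i, κ i = k → a i ≤ 2) := by
    by_cases hk : k ∈ univ.image κ
    · obtain ⟨M, hc, hs, hsq, h1⟩ := ht k hk
      obtain ⟨a, rfl⟩ := exists_map_eq_of_card_eq _ M hc
      refine ⟨a, fun _ => ⟨hs, ?_, fun h i hi => h1 h _ (Multiset.mem_map_of_mem _ (by simpa))⟩⟩
      rwa [Multiset.map_map] at hsq
    · exact ⟨0, fun h => absurd h hk⟩
  choose a ha using this
  refine ⟨fun i => a (κ i) i, ?_, fun k => ?_, fun i hi => ?_⟩
  · rw [← hts, ← sum_fiberwise_of_maps_to (g := κ) (t := univ.image κ) (by simp)]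
    refine sum_congr rfl fun k hk => ?_
    rw [← (ha k hk).1]
    exact sum_congr rfl fun i hi => by rw [(mem_filter.1 hi).2]
  · by_cases hk : k ∈ univ.image κ
    · convert (ha k hk).2.1 using 1
      exact sum_congr rfl fun i hi => by simp only [(mem_filter.1 hi).2]
    · rw [sum_eq_zero]
      · exact ⟨0, rfl⟩
      · intro i hi
        exact absurd (mem_image.2 ⟨i, mem_univ _, (mem_filter.1 hi).2⟩) hk
  · refine (ha _ (mem_image_of_mem κ (mem_univ i))).2.2 (card_eq_one.2 ⟨i, ?_⟩) i rfl
    ext j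
    simp only [mem_filter, mem_univ, true_and, mem_singleton]
    exact ⟨hi j, by rintro rfl; rfl⟩

/-! ### Ramsey theory: monochromatic blocks -/

/-- All pairs of distinct elements of `Y` have colour `k`. -/
def MonoOn {V : Type} (c : Sym2 V → ℕ) (k : ℕ) (Y : Finset V) : Prop :=
  ∀ x ∈ Y, ∀ y ∈ Y, x ≠ y → c s(x, y) = k

lemma MonoOn.mono {V : Type} {c : Sym2 V → ℕ} {k : ℕ} {Y Z : Finset V} (h : MonoOn c k Y)
    (hZ : Z ⊆ Y) : MonoOn c k Z :=
  fun x hx y hy => h x (hZ hx) y (hZ hy)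

lemma MonoOn.insert {V : Type} [DecidableEq V] {c : Sym2 V → ℕ} {k : ℕ} {Y : Finset V} {x : V}
    (h : MonoOn c k Y) (hx : ∀ y ∈ Y, c s(x, y) = k) : MonoOn c k (insert x Y) := by
  intro a ha b hb hab
  rcases mem_insert.1 ha with rfl | ha' <;> rcases mem_insert.1 hb with rfl | hb'
  · exact absurd rfl hab
  · exact hx b hb'
  · rw [Sym2.eq_swap]; exact hx a ha'
  · exact h a ha' b hb' hab

/-- **Ramsey's theorem** for graphs and finitely many colours. -/
theorem exists_ramsey (r m : ℕ) : ∃ N, ∀ K : Finset ℕ, #K ≤ r → ∀ w : ℕ → ℕ, ∑ k ∈ K, w k ≤ m →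
    ∀ {V : Type} [DecidableEq V] (c : Sym2 V → ℕ) (X : Finset V), N ≤ #X →
    (∀ x ∈ X, ∀ y ∈ X, x ≠ y → c s(x, y) ∈ K) →
    ∃ k ∈ K, ∃ Y ⊆ X, #Y = w k ∧ MonoOn c k Y := by
  induction m with
  | zero =>
    -- Two vertices guarantee an edge, hence a colour in `K`; its target size is 0.
    refine ⟨2, fun K _ w hw V _ c X hX hc => ?_⟩
    obtain ⟨x, hx, y, hy, hxy⟩ := one_lt_card.1 hX
    have hk := hc x hx y hy hxy
    refine ⟨_, hk, ∅, empty_subset _, ?_, by simp [MonoOn]⟩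
    have := single_le_sum (f := w) (fun _ _ => Nat.zero_le _) hk
    simp only [card_empty]
    omega
  | succ m ih =>
    obtain ⟨N, hN⟩ := ih
    refine ⟨r * N + 2, fun K hK w hw V _ c X hX hc => ?_⟩
    by_cases h0 : ∃ k ∈ K, w k = 0
    · obtain ⟨k, hk, h0⟩ := h0
      exact ⟨k, hk, ∅, empty_subset _, by simp [h0], by simp [MonoOn]⟩
    push Not at h0
    obtain ⟨x, hx⟩ : X.Nonempty := card_pos.1 (by omega)
    have hcard := card_erase_of_mem hx
    obtain ⟨k, hk, hlt⟩ := exists_lt_card_fiber_of_mul_lt_card_of_maps_to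
      (s := X.erase x) (t := K) (f := fun y => c s(x, y)) (n := N)
      (fun y hy => hc x hx y (mem_of_mem_erase hy) (ne_of_mem_erase hy).symm)
      (by have := Nat.mul_le_mul_right N hK; omega)
    set X' := {y ∈ X.erase x | c s(x, y) = k} with hX'
    have hX'X : X' ⊆ X := (filter_subset _ _).trans (erase_subset _ _)
    have hwk := h0 k hk
    obtain ⟨l, hl, Y, hY, hYc, hYm⟩ := hN K hK (Function.update w k (w k - 1)) (by
        rw [sum_update_of_mem hk]
        have := sum_sdiff (f := w) (singleton_subset_iff.2 hk)
        rw [sum_singleton] at this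
        omega)
      c X' hlt.le (fun a ha b hb => hc a (hX'X ha) b (hX'X hb))
    rcases eq_or_ne l k with rfl | hne
    · rw [Function.update_self] at hYc
      have hxY : x ∉ Y := fun h => by simpa [hX'] using hY h
      refine ⟨l, hl, insert x Y, insert_subset hx (hY.trans hX'X), ?_,
        hYm.insert fun y hy => (mem_filter.1 (hY hy)).2⟩
      rw [card_insert_of_notMem hxY]
      omega
    · rw [Function.update_of_ne hne] at hYc
      exact ⟨l, hl, Y, hY.trans hX'X, hYc, hYm⟩

/-- A large edge-coloured complete graph contains a rainbow matching (one edge for each colour in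
`L`) or a large monochromatic clique. -/
theorem exists_rainbow_matching_or_mono (s M : ℕ) : ∃ t, ∀ {V : Type} [DecidableEq V]
    (c : Sym2 V → ℕ) (X : Finset V), t ≤ #X →
    (∃ (L : Finset ℕ) (B : ℕ → Finset V), #L = M ∧
      ∀ k ∈ L, #(B k) = 2 ∧ B k ⊆ X ∧ MonoOn c k (B k) ∧ ∀ l ∈ L, l ≠ k → Disjoint (B l) (B k)) ∨
    ∃ k, ∃ Y ⊆ X, #Y = s ∧ MonoOn c k Y := by
  induction M with
  | zero => exact ⟨0, fun c X _ => .inl ⟨∅, fun _ => ∅, by simp⟩⟩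
  | succ M ih =>
    obtain ⟨t, ht⟩ := ih
    obtain ⟨N, hN⟩ := exists_ramsey M (M * s)
    -- Deleting the 2M matched vertices leaves N. Either a new colour appears there and extends the
    -- matching, or only the M colours of `L` remain and Ramsey applies.
    refine ⟨t + N + 2 * M, fun {V} _ c X hX => ?_⟩
    rcases ht c X (by omega) with ⟨L, B, hL, hB⟩ | h
    swap
    · exact .inr h
    set X' := X \ L.biUnion B with hX'
    have hc : N ≤ #X' := by
      have h1 : #X - #(L.biUnion B) ≤ #X' := le_card_sdiff (L.biUnion B) X
      have h2 : #(L.biUnion B) ≤ #L * 2 := card_biUnion_le_card_mul _ _ _ fun k hk => (hB k hk).1.le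
      omega
    by_cases hnew : ∃ x ∈ X', ∃ y ∈ X', x ≠ y ∧ c s(x, y) ∉ L
    · obtain ⟨x, hx, y, hy, hxy, hxyL⟩ := hnew
      set k := c s(x, y) with hk
      have hdisj (l) (hl : l ∈ L) : Disjoint (B l) {x, y} := by
        simp only [hX', mem_sdiff, mem_biUnion, not_exists, not_and] at hx hy
        rw [disjoint_right]
        intro z hz
        rcases mem_insert.1 hz with rfl | hz
        · exact hx.2 l hl
        · rw [mem_singleton.1 hz]; exact hy.2 l hl
      have hupd (l) (hl : l ∈ L) : Function.update B k {x, y} l = B l :=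
        Function.update_of_ne (by rintro rfl; exact hxyL hl) _ _
      refine .inl ⟨insert k L, Function.update B k {x, y}, ?_, ?_⟩
      · rw [card_insert_of_notMem hxyL, hL]
      · intro l hl
        rcases mem_insert.1 hl with rfl | hl
        · rw [Function.update_self]
          refine ⟨card_pair hxy, ?_, ?_, ?_⟩
          · exact insert_subset (mem_sdiff.1 hx).1 (singleton_subset_iff.2 (mem_sdiff.1 hy).1)
          · refine MonoOn.insert (by simp [MonoOn]) ?_
            intro z hz
            rw [mem_singleton.1 hz]
          · intro l hl hlk
            have hl' := (mem_insert.1 hl).resolve_left hlk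
            rw [hupd l hl']
            exact hdisj l hl'
        · rw [hupd l hl]
          refine ⟨(hB l hl).1, (hB l hl).2.1, (hB l hl).2.2.1, fun j hj hjl => ?_⟩
          rcases mem_insert.1 hj with rfl | hj
          · rw [Function.update_self]
            exact (hdisj l hl).symm
          · rw [hupd j hj]
            exact (hB l hl).2.2.2 j hj hjl
    · push Not at hnew
      obtain ⟨k, -, Y, hY, h1, h2⟩ := hN L hL.le (fun _ => s) (by simp [hL]) c X' hc hnew
      exact .inr ⟨k, Y, hY.trans sdiff_subset, h1, h2⟩

/-- `M` disjoint monochromatic blocks inside a coloured complete graph. Either the blocks are edges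
of pairwise distinct colours, or they are cliques of order `p` of the same colour. -/
structure IsBlockSystem {V : Type} (c : Sym2 V → ℕ) (p M : ℕ) (B : Fin M → Finset V)
    (κ : Fin M → ℕ) : Prop where
  mono : ∀ a, MonoOn c (κ a) (B a)
  disjoint : ∀ a b, a ≠ b → Disjoint (B a) (B b)
  type : (Function.Injective κ ∧ ∀ a, #(B a) = 2) ∨ ∀ a, #(B a) = p

theorem exists_isBlockSystem (p M : ℕ) : ∃ t, ∀ {V : Type} [DecidableEq V]
    (c : Sym2 V → ℕ) (X : Finset V), t ≤ #X →
    ∃ B : Fin M → Finset V, ∃ κ, (∀ a, B a ⊆ X) ∧ IsBlockSystem c p M B κ := by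
  obtain ⟨t, ht⟩ := exists_rainbow_matching_or_mono (M * p) M
  refine ⟨t, fun {V} _ c X hX => ?_⟩
  rcases ht c X hX with ⟨L, B, hL, hB⟩ | ⟨k, Y, hYX, hY, hm⟩
  · let e := (L.equivFinOfCardEq hL).symm
    refine ⟨fun a => B (e a), fun a => e a, fun a => (hB _ (e a).2).2.1,
      fun a => (hB _ (e a).2).2.2.1, fun a b hab => (hB _ (e b).2).2.2.2 _ (e a).2 ?_,
      .inl ⟨Subtype.val_injective.comp e.injective, fun a => (hB _ (e a).2).1⟩⟩
    exact fun h => hab (e.injective (Subtype.ext h))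
  -- A monochromatic clique of order M * p is cut into M cliques of order p.
  · let e := finProdFinEquiv.trans (Y.equivFinOfCardEq hY).symm
    have he (a b a' b') (h : (e (a, b) : V) = e (a', b')) : a = a' ∧ b = b' := by
      simpa using e.injective (Subtype.ext h)
    have hsub (a) : univ.image (fun b => (e (a, b) : V)) ⊆ Y := by
      intro x hx
      obtain ⟨b, -, rfl⟩ := mem_image.1 hx
      exact (e (a, b)).2
    refine ⟨fun a => univ.image fun b => (e (a, b) : V), fun _ => k,
      fun a => (hsub a).trans hYX, fun a => hm.mono (hsub a), fun a b hab => ?_,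
      .inr fun a => ?_⟩
    · rw [disjoint_left]
      intro x hx hx'
      obtain ⟨i, -, rfl⟩ := mem_image.1 hx
      obtain ⟨j, -, h⟩ := mem_image.1 hx'
      exact hab (he _ _ _ _ h).1.symm
    · rw [card_image_of_injective _ fun b b' h => (he _ _ _ _ h).2, card_univ, Fintype.card_fin]

/-! ### Choosing compatible blocks -/

/-- If every `(i, α)` is in conflict with at most `D` of the options for each other index, then
there is a conflict-free choice of options, provided that there are many options. -/
theorem exists_conflict_free {ι : Type} [Fintype ι] [DecidableEq ι] (D M : ℕ)
    (hM : Fintype.card ι * Fintype.card ι * D < M) (R : ι → Fin M → ι → Fin M → Prop)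
    (hR : ∀ i α j, i ≠ j → ∀ T : Finset (Fin M), (∀ β ∈ T, R i α j β) → #T ≤ D) :
    ∃ a : ι → Fin M, ∀ i j, i ≠ j → ¬ R i (a i) j (a j) := by
  classical
  by_contra! hcon
  have : NeZero M := ⟨by omega⟩
  let bad (i j : ι) : Finset (ι → Fin M) := {a | R i (a i) j (a j)}
  have hbad (i j) (hij : i ≠ j) : #(bad i j) * M ≤ D * Fintype.card (ι → Fin M) := by
    -- Overwriting coordinate j of a bad choice preserves coordinate i, so only the old value at j
    -- is lost, and it has at most D possibilities. Thus a proportion of at most D / M of all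
    -- choices is bad for (i, j), and a union bound finishes.
    have := card_le_mul_card_image_of_maps_to (s := bad i j ×ˢ (univ : Finset (Fin M)))
      (t := (univ : Finset (ι → Fin M))) (f := fun x => Function.update x.1 j x.2)
      (fun _ _ => mem_univ _) D ?_
    · simpa [card_product] using this
    · intro b _
      rw [← card_image_of_injOn (f := fun x => x.1 j)]
      · refine hR i (b i) j hij _ fun β hβ => ?_
        obtain ⟨⟨a, γ⟩, hx, rfl⟩ := mem_image.1 hβ
        simp only [mem_filter, mem_product, mem_univ, and_true, bad, true_and] at hx
        obtain ⟨h1, rfl⟩ := hx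
        rwa [Function.update_of_ne hij]
      · rintro ⟨a, γ⟩ hx ⟨a', γ'⟩ hx' h
        simp only [coe_filter, Set.mem_ofPred_eq] at hx hx' h
        have h' : Function.update a j γ = Function.update a' j γ' := hx.2.trans hx'.2.symm
        have hγ : γ = γ' := by simpa using congrFun h' j
        refine Prod.ext (funext fun l => ?_) hγ
        rcases eq_or_ne l j with rfl | hl
        · exact h
        · simpa [hl] using congrFun h' l
  have hcover : (univ : Finset (ι → Fin M)) ⊆ (univ : Finset ι).offDiag.biUnion
      fun x => bad x.1 x.2 := by
    intro a _
    obtain ⟨i, j, hij, h⟩ := hcon a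
    exact mem_biUnion.2 ⟨(i, j), by simpa using hij, by simpa [bad] using h⟩
  have h1 := (card_le_card hcover).trans card_biUnion_le
  rw [card_univ] at h1
  have h2 := Nat.mul_le_mul_right M h1
  rw [sum_mul] at h2
  have h3 := h2.trans (sum_le_card_nsmul _ _ _ fun x hx => hbad x.1 x.2 (by simpa using hx))
  have h4 : #(univ : Finset ι).offDiag ≤ Fintype.card ι * Fintype.card ι := by
    rw [offDiag_card, card_univ]; exact Nat.sub_le _ _
  have hpos : 0 < Fintype.card (ι → Fin M) := Fintype.card_pos
  rw [smul_eq_mul] at h3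
  nlinarith [Nat.mul_le_mul_right (D * Fintype.card (ι → Fin M)) h4,
    Nat.mul_lt_mul_of_pos_right hM hpos]

/-- The edges of the complete graph with vertex set `S`. -/
def pairs {V : Type} [DecidableEq V] (S : Finset V) : Finset (Sym2 V) :=
  S.offDiag.image Sym2.mk.uncurry

lemma mk_mem_pairs {V : Type} [DecidableEq V] {S : Finset V} {x y : V} :
    s(x, y) ∈ pairs S ↔ x ∈ S ∧ y ∈ S ∧ x ≠ y := by
  simp only [pairs, mem_image, mem_offDiag, Prod.exists, Function.uncurry_apply_pair, Sym2.eq_iff]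
  constructor
  · rintro ⟨a, b, ⟨ha, hb, hab⟩, ⟨rfl, rfl⟩ | ⟨rfl, rfl⟩⟩
    · exact ⟨ha, hb, hab⟩
    · exact ⟨hb, ha, hab.symm⟩
  · exact fun h => ⟨x, y, h, .inl ⟨rfl, rfl⟩⟩

lemma card_pairs {V : Type} [DecidableEq V] (S : Finset V) : #(pairs S) = (#S).choose 2 :=
  Sym2.card_image_offDiag S

/-- Colour counts in a union of monochromatic sets from different parts, when the edges between
different parts are rainbow and use none of the colours of the monochromatic sets. -/
lemma isSquare_card_pairs_filter {V ι : Type} [DecidableEq V] [Fintype ι] [DecidableEq ι]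
    (c : Sym2 V → ℕ) (part : V → ι) (S : ι → Finset V) (κ : ι → ℕ)
    (hpart : ∀ i, ∀ x ∈ S i, part x = i) (hmono : ∀ i, MonoOn c (κ i) (S i))
    (hcross : ∀ i, ∀ x ∈ univ.biUnion S, ∀ y ∈ univ.biUnion S, part x ≠ part y → c s(x, y) ≠ κ i)
    (hrainbow : ∀ x y x' y', part x ≠ part y → part x' ≠ part y' →
      c s(x, y) = c s(x', y') → s(x, y) = s(x', y'))
    (hsq : ∀ k, IsSquare (∑ i with κ i = k, (#(S i)).choose 2)) (k : ℕ) :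
    IsSquare #{e ∈ pairs (univ.biUnion S) | c e = k} := by
  have hmem {x : V} (hx : x ∈ univ.biUnion S) : x ∈ S (part x) := by
    obtain ⟨i, -, hi⟩ := mem_biUnion.1 hx
    rwa [hpart i x hi]
  by_cases h : ∃ x ∈ univ.biUnion S, ∃ y ∈ univ.biUnion S, part x ≠ part y ∧ c s(x, y) = k
  · obtain ⟨x, hx, y, hy, hxy, hk⟩ := h
    -- A colour seen on a cross edge occurs nowhere else, so its class has 1 = 1² edge.
    refine ⟨1, card_eq_one.2 ⟨s(x, y), ?_⟩⟩
    ext e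
    induction e using Sym2.ind with
    | _ a b =>
    rw [mem_filter, mem_singleton]
    constructor
    · rintro ⟨hab, habk⟩
      obtain ⟨ha, hb, hne⟩ := mk_mem_pairs.1 hab
      by_cases hp : part a = part b
      · refine absurd ?_ (hcross (part a) x hx y hy hxy)
        rw [hk, ← habk]
        exact hmono _ a (hmem ha) b (hp ▸ hmem hb) hne
      · exact hrainbow _ _ _ _ hp hxy (habk.trans hk.symm)
    · intro hab
      rw [hab]
      exact ⟨mk_mem_pairs.2 ⟨hx, hy, fun h => hxy (h ▸ rfl)⟩, hk⟩
  · push Not at h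
    convert hsq k
    have : {e ∈ pairs (univ.biUnion S) | c e = k} =
        ({i | κ i = k} : Finset ι).biUnion fun i => pairs (S i) := by
      ext e
      induction e using Sym2.ind with
      | _ a b =>
      simp only [mem_filter, mk_mem_pairs, mem_biUnion (s := ({i | κ i = k} : Finset ι)), mem_univ,
        true_and]
      constructor
      · rintro ⟨⟨ha, hb, hne⟩, hk⟩
        have hp : part a = part b := by
          by_contra hp
          exact h a ha b hb hp hk
        have hb' := hmem hb
        rw [← hp] at hb'
        exact ⟨part a, (hmono _ a (hmem ha) b hb' hne).symm.trans hk, hmem ha, hb', hne⟩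
      · rintro ⟨i, rfl, ha, hb, hne⟩
        exact ⟨⟨mem_biUnion.2 ⟨i, mem_univ _, ha⟩, mem_biUnion.2 ⟨i, mem_univ _, hb⟩, hne⟩,
          hmono i a ha b hb hne⟩
    rw [this, card_biUnion]
    · simp only [card_pairs]
    · intro i _ j _ hij
      refine disjoint_left.2 ?_
      intro e
      induction e using Sym2.ind with
      | _ a b =>
      intro h1 h2
      rw [mk_mem_pairs] at h1 h2
      exact hij ((hpart i a h1.1).symm.trans (hpart j a h2.1))

theorem exists_square_clique {ι : Type} [Fintype ι] [DecidableEq ι] (p : ℕ)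
    (hι : 3 ≤ Fintype.card ι) (hp : p = 2 * Fintype.card ι ∨ p = 2 * Fintype.card ι - 1) :
    ∃ t, ∀ {V : Type} [DecidableEq V] (c : Sym2 V → ℕ) (part : V → ι) (X : ι → Finset V),
    (∀ i, ∀ x ∈ X i, part x = i) → (∀ i, t ≤ #(X i)) →
    (∀ x y x' y', part x ≠ part y → part x' ≠ part y' →
      c s(x, y) = c s(x', y') → s(x, y) = s(x', y')) →
    ∃ S : Finset V, #S = p ∧ ∀ k, IsSquare #{e ∈ pairs S | c e = k} := by
  classical
  obtain ⟨t, ht⟩ := exists_isBlockSystem p (Fintype.card ι * Fintype.card ι * 2 + 1)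
  refine ⟨t, fun {V} _ c part X hX hXt hrainbow => ?_⟩
  choose B κ hBX hB using fun i => ht c (X i) (hXt i)
  have hpart (i α x) (hx : x ∈ B i α) : part x = i := hX i x (hBX i α hx)
  -- D = 2: one option of j may repeat the colour when the colours of j are injective, and one may
  -- meet the unique cross edge of that colour, since the blocks of j are disjoint.
  obtain ⟨a, ha⟩ := exists_conflict_free 2 _ (Nat.lt_succ_self _)
    (fun i α j β => (Function.Injective (κ j) ∧ κ j β = κ i α) ∨
      ∃ x ∈ B j β, ∃ y, part y ≠ part x ∧ c s(x, y) = κ i α) (by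
    intro i α j hij T hT
    have hT' : T ⊆ {β ∈ T | Function.Injective (κ j) ∧ κ j β = κ i α} ∪
        {β ∈ T | ∃ x ∈ B j β, ∃ y, part y ≠ part x ∧ c s(x, y) = κ i α} := by
      intro β hβ
      rcases hT β hβ with h | h
      · exact mem_union_left _ (mem_filter.2 ⟨hβ, h⟩)
      · exact mem_union_right _ (mem_filter.2 ⟨hβ, h⟩)
    refine ((card_le_card hT').trans (card_union_le _ _)).trans
      (Nat.add_le_add (b := 1) (d := 1) ?_ ?_)
    · refine card_le_one.2 fun β hβ γ hγ => ?_
      simp only [mem_filter] at hβ hγ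
      exact hβ.2.1 (hβ.2.2.trans hγ.2.2.symm)
    · refine card_le_one.2 fun β hβ γ hγ => ?_
      simp only [mem_filter] at hβ hγ
      obtain ⟨-, x, hx, y, hyx, h⟩ := hβ
      obtain ⟨-, x', hx', y', hyx', h'⟩ := hγ
      by_contra hne
      rcases Sym2.eq_iff.1 (hrainbow _ _ _ _ hyx.symm hyx'.symm (h.trans h'.symm)) with
        ⟨rfl, -⟩ | ⟨rfl, rfl⟩
      · exact disjoint_left.1 ((hB j).disjoint β γ hne) hx hx'
      · exact hyx ((hpart _ _ _ hx').trans (hpart _ _ _ hx).symm))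
  push Not at ha
  obtain ⟨b, hbp, hbsq, hb1⟩ := exists_part_sizes (fun i => κ i (a i)) p hι hp
  have hsize (i) : b i ≤ #(B i (a i)) := by
    rcases (hB i).type with ⟨hinj, h2⟩ | h
    · rw [h2]
      -- A single edge offers only two vertices; this suffices because its colour is not shared with
      -- another part.
      refine hb1 i fun j hj => ?_
      by_contra hij
      exact (ha j i hij).1 hinj hj.symm
    · rw [h, ← hbp]
      exact single_le_sum (f := b) (fun _ _ => Nat.zero_le _) (mem_univ i)
  choose S hSB hSc using fun i => exists_subset_card_eq (hsize i)
  have hSpart (i x) (hx : x ∈ S i) : part x = i := hpart i _ x (hSB i hx)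
  refine ⟨univ.biUnion S, ?_, isSquare_card_pairs_filter c part S (fun i => κ i (a i)) hSpart
    (fun i => ((hB i).mono (a i)).mono (hSB i)) ?_ hrainbow (by simpa only [hSc] using hbsq)⟩
  · rw [card_biUnion, ← hbp]
    · exact sum_congr rfl fun i _ => hSc i
    · intro i _ j _ hij
      refine disjoint_left.2 ?_
      exact fun x h1 h2 => hij ((hSpart i x h1).symm.trans (hSpart j x h2))
  · intro i x hx y hy hxy
    obtain ⟨j, -, hj⟩ := mem_biUnion.1 hx
    obtain ⟨l, -, hl⟩ := mem_biUnion.1 hy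
    by_cases hij : i = j
    · have hil : i ≠ l := by
        rintro rfl
        exact hxy ((hSpart _ _ hj).trans (hij.symm.trans (hSpart _ _ hl).symm))
      rw [Sym2.eq_swap]
      exact (ha i l hil).2 y (hSB l hl) x hxy
    · exact (ha i j hij).2 x (hSB j hj) y hxy.symm

/-! ### From copies of K_p to vertex sets -/

lemma ncard_edgeSet_edgeInduced {V : Type} (H : SimpleGraph V) :
    (edgeInduced H).edgeSet.ncard = H.edgeSet.ncard := by
  rw [← Set.ncard_image_of_injective _ (Sym2.map.injective Subtype.val_injective)]
  congr 1
  ext e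
  induction e using Sym2.ind with
  | _ a b =>
  simp only [Set.mem_image, SimpleGraph.mem_edgeSet]
  constructor
  · rintro ⟨e, he, h⟩
    induction e using Sym2.ind with
    | _ x y =>
    rw [← SimpleGraph.mem_edgeSet, ← h]
    exact he
  · intro h
    exact ⟨s(⟨a, b, h⟩, ⟨b, a, h.symm⟩), h, rfl⟩

/-- An edge colouring of a complete graph, extended by the colour `0` on the diagonal. -/
noncomputable def extendColoring {V : Type} (C : (⊤ : SimpleGraph V).EdgeLabeling ℕ)
    (e : Sym2 V) : ℕ :=
  open Classical in if h : e ∈ (⊤ : SimpleGraph V).edgeSet then C ⟨e, h⟩ else 0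

lemma extendColoring_coe {V : Type} (C : (⊤ : SimpleGraph V).EdgeLabeling ℕ)
    (e : (⊤ : SimpleGraph V).edgeSet) : extendColoring C e = C e := by
  rw [extendColoring, dif_pos e.2]

lemma ncard_edgeSet_labelGraph_pullback {n p : ℕ} (C : (⊤ : SimpleGraph (Fin n)).EdgeLabeling ℕ)
    (φ : (K p).Copy (⊤ : SimpleGraph (Fin n))) (k : ℕ) :
    ((C.pullback φ.toHom).labelGraph k).edgeSet.ncard =
      #{e ∈ pairs (univ.image φ.toHom) | extendColoring C e = k} := by
  have hinj : Function.Injective φ.toHom := φ.injective'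
  rw [← Set.ncard_image_of_injective _ (Sym2.map.injective hinj), ← Set.ncard_coe_finset]
  have key (x y : Fin p) (h : x ≠ y) : ((C.pullback φ.toHom).labelGraph k).Adj x y ↔
      extendColoring C s(φ.toHom x, φ.toHom y) = k := by
    rw [SimpleGraph.EdgeLabeling.labelGraph_adj]
    have := extendColoring_coe C (φ.toHom.mapEdgeSet ⟨s(x, y), h⟩)
    constructor
    · rintro ⟨_, h'⟩
      exact this.trans h'
    · exact fun h' => ⟨h, this.symm.trans h'⟩
  congr 1
  ext e
  simp only [Set.mem_image, coe_filter, Set.mem_ofPred_eq]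
  constructor
  · rintro ⟨e, he, rfl⟩
    induction e using Sym2.ind with
    | _ x y =>
    have hxy : x ≠ y := SimpleGraph.Adj.ne (SimpleGraph.mem_edgeSet _ |>.1 he)
    exact ⟨mk_mem_pairs.2 ⟨mem_image_of_mem _ (mem_univ _), mem_image_of_mem _ (mem_univ _),
      hinj.ne hxy⟩, (key x y hxy).1 he⟩
  · induction e using Sym2.ind with
    | _ a b =>
    rintro ⟨hab, hk⟩
    obtain ⟨ha, hb, hne⟩ := mk_mem_pairs.1 hab
    obtain ⟨x, -, rfl⟩ := mem_image.1 ha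
    obtain ⟨y, -, rfl⟩ := mem_image.1 hb
    have hxy : x ≠ y := fun h => hne (h ▸ rfl)
    exact ⟨s(x, y), (key x y hxy).2 hk, rfl⟩

/-- A copy of `K_p` is good for the family of graphs with a square number of edges iff each colour
occurs a square number of times. -/
lemma allClassesIn_squareFamily_iff {n p : ℕ} (C : (⊤ : SimpleGraph (Fin n)).EdgeLabeling ℕ)
    (φ : (K p).Copy (⊤ : SimpleGraph (Fin n))) :
    AllClassesIn squareFamily (C.pullback φ.toHom) ↔
      ∀ k, IsSquare #{e ∈ pairs (univ.image φ.toHom) | extendColoring C e = k} := by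
  simp only [AllClassesIn, squareFamily, ncard_edgeSet_edgeInduced,
    ncard_edgeSet_labelGraph_pullback]
  constructor
  · intro h k
    rcases eq_or_ne #{e ∈ pairs (univ.image φ.toHom) | extendColoring C e = k} 0 with h0 | h0
    · rw [h0]; exact ⟨0, rfl⟩
    · rw [← ncard_edgeSet_labelGraph_pullback] at h0
      obtain ⟨e, he⟩ := Set.nonempty_of_ncard_ne_zero h0
      have hk : ∃ h', (C.pullback φ.toHom) ⟨e, h'⟩ = k := by
        induction e using Sym2.ind with
        | _ x y => exact (SimpleGraph.EdgeLabeling.labelGraph_adj x y).1 he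
      obtain ⟨h', hk⟩ := hk
      obtain ⟨r, -, hr⟩ := h ⟨e, h'⟩
      rw [hk] at hr
      exact ⟨r, hr.trans (sq r)⟩
  · intro h e
    obtain ⟨r, hr⟩ := h ((C.pullback φ.toHom) e)
    refine ⟨r, Nat.one_le_iff_ne_zero.2 ?_, hr.trans (sq r).symm⟩
    rintro rfl
    rw [← ncard_edgeSet_labelGraph_pullback, Nat.mul_zero, Set.ncard_eq_zero] at hr
    obtain ⟨e, he⟩ := e
    have : e ∈ ((C.pullback φ.toHom).labelGraph ((C.pullback φ.toHom) ⟨e, he⟩)).edgeSet := by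
      induction e using Sym2.ind with
      | _ x y => exact (SimpleGraph.EdgeLabeling.labelGraph_adj x y).2 ⟨he, rfl⟩
    rw [hr] at this
    exact this

lemma exists_copy_of_finset {n p : ℕ} (C : (⊤ : SimpleGraph (Fin n)).EdgeLabeling ℕ)
    (S : Finset (Fin n)) (hS : #S = p)
    (h : ∀ k, IsSquare #{e ∈ pairs S | extendColoring C e = k}) :
    ∃ φ : (K p).Copy (⊤ : SimpleGraph (Fin n)), AllClassesIn squareFamily (C.pullback φ.toHom) := by
  let g := S.orderEmbOfFin hS
  let φ : (K p).Copy (⊤ : SimpleGraph (Fin n)) := ⟨⟨g, fun h => g.injective.ne h⟩, g.injective⟩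
  refine ⟨φ, (allClassesIn_squareFamily_iff C φ).2 ?_⟩
  have : univ.image φ.toHom = S := by
    ext x
    rw [← mem_coe, ← mem_coe, ← range_orderEmbOfFin S hS]
    simp [φ, g]
  rwa [this]

/-- A colouring of `K_n` has a rainbow subgraph that contains an edge of each colour. -/
lemma exists_rainbow_subgraph {n : ℕ} (C : (⊤ : SimpleGraph (Fin n)).EdgeLabeling ℕ) :
    ∃ G : SimpleGraph (Fin n), G.edgeSet.ncard = numColors C ∧
      Set.InjOn (extendColoring C) G.edgeSet := by
  obtain ⟨s, -, hs⟩ := Set.exists_subset_bijOn Set.univ (fun e => C e)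
  have hE : (SimpleGraph.fromEdgeSet (Subtype.val '' s)).edgeSet = Subtype.val '' s := by
    rw [SimpleGraph.edgeSet_fromEdgeSet, sdiff_eq_left, Set.disjoint_left]
    rintro _ ⟨e, -, rfl⟩
    exact SimpleGraph.not_isDiag_of_mem_edgeSet _ e.2
  refine ⟨SimpleGraph.fromEdgeSet (Subtype.val '' s), ?_, ?_⟩
  · rw [hE, Set.ncard_image_of_injective _ Subtype.val_injective, ← hs.injOn.ncard_image,
      hs.image_eq, Set.image_univ]
    rfl
  · rw [hE]
    rintro _ ⟨e, he, rfl⟩ _ ⟨e', he', rfl⟩ h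
    rw [extendColoring_coe, extendColoring_coe] at h
    rw [hs.injOn he he' h]

lemma numColors_le {n : ℕ} (C : (⊤ : SimpleGraph (Fin n)).EdgeLabeling ℕ) :
    numColors C ≤ Fintype.card (Sym2 (Fin n)) := by
  obtain ⟨G, hG, -⟩ := exists_rainbow_subgraph C
  rw [← hG, ← Nat.card_eq_fintype_card, ← Set.ncard_univ]
  exact Set.ncard_le_ncard (Set.subset_univ _)

lemma numColors_lt_f {n : ℕ} {V : Type} {G : SimpleGraph V} {F : GraphFamily}
    (C : (⊤ : SimpleGraph (Fin n)).EdgeLabeling ℕ)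
    (hC : ∀ φ : G.Copy (⊤ : SimpleGraph (Fin n)), ¬ AllClassesIn F (C.pullback φ.toHom)) :
    numColors C < f n G F := by
  -- Nonemptiness matters: `sInf` of the empty set would be 0. A threshold above the number of all
  -- pairs qualifies vacuously.
  have hne : {m : ℕ | 1 ≤ m ∧ ∀ C : (⊤ : SimpleGraph (Fin n)).EdgeLabeling ℕ, m ≤ numColors C →
      ∃ φ : G.Copy (⊤ : SimpleGraph (Fin n)), AllClassesIn F (C.pullback φ.toHom)}.Nonempty :=
    ⟨Fintype.card (Sym2 (Fin n)) + 1, by omega, fun C h => by have := numColors_le C; omega⟩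
  by_contra! h
  obtain ⟨φ, hφ⟩ := (Nat.sInf_mem hne).2 C h
  exact hC φ hφ

/-! ### Upper bound by the extremal number of a complete multipartite graph -/

theorem exists_f_le_extremalNumber (p q : ℕ) (hq : 3 ≤ q) (hp : p = 2 * q ∨ p = 2 * q - 1) :
    ∃ t, ∀ n, f n (K p) squareFamily ≤
      SimpleGraph.extremalNumber n (SimpleGraph.completeEquipartiteGraph q t) + 1 := by
  classical
  obtain ⟨t, ht⟩ := exists_square_clique (ι := Fin q) p (by simpa) (by simpa)
  refine ⟨t, fun n => Nat.sInf_le ⟨by omega, fun C hC => ?_⟩⟩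
  obtain ⟨G, hG, hinj⟩ := exists_rainbow_subgraph C
  obtain ⟨g⟩ := SimpleGraph.IsContained.of_extremalNumber_lt_card_edgeFinset
    (G := G) (H := SimpleGraph.completeEquipartiteGraph q t) (by
      rw [← Set.ncard_coe_finset, SimpleGraph.coe_edgeFinset, hG, Fintype.card_fin]
      omega)
  have hginj : Function.Injective g.toHom := g.injective'
  have hadj (x y : Fin q × Fin t) (h : x.1 ≠ y.1) : s(g.toHom x, g.toHom y) ∈ G.edgeSet :=
    g.toHom.map_adj (v := x) (w := y) h
  -- The colouring is pulled back to `Fin q × Fin t`, where the parts are the fibres of the first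
  -- projection.
  obtain ⟨S, hS, hsq⟩ := ht (fun e => extendColoring C (e.map g.toHom)) Prod.fst
    (fun i => {x | x.1 = i}) (by simp) (fun i => by
      refine (le_of_eq ?_).trans (card_le_card (s := univ.image fun b : Fin t => (i, b)) ?_)
      · rw [card_image_of_injective _ fun a b h => congrArg Prod.snd h, card_univ, Fintype.card_fin]
      · intro x hx
        obtain ⟨b, -, rfl⟩ := mem_image.1 hx
        simp)
    (fun x y x' y' h h' hc =>
      Sym2.map.injective hginj (hinj (hadj x y h) (hadj x' y' h') hc))
  refine exists_copy_of_finset C (S.image g.toHom) (by rw [card_image_of_injective _ hginj, hS])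
    fun k => ?_
  have : {e ∈ pairs (S.image g.toHom) | extendColoring C e = k} =
      {e ∈ pairs S | extendColoring C (e.map g.toHom) = k}.image (Sym2.map g.toHom) := by
    ext e
    simp only [mem_filter, mem_image]
    constructor
    · induction e using Sym2.ind with
      | _ a b =>
      rintro ⟨hab, hk⟩
      obtain ⟨ha, hb, hne⟩ := mk_mem_pairs.1 hab
      obtain ⟨x, hx, rfl⟩ := mem_image.1 ha
      obtain ⟨y, hy, rfl⟩ := mem_image.1 hb
      exact ⟨s(x, y), ⟨mk_mem_pairs.2 ⟨hx, hy, fun h => hne (h ▸ rfl)⟩, hk⟩, rfl⟩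
    · rintro ⟨e, ⟨he, hk⟩, rfl⟩
      induction e using Sym2.ind with
      | _ x y =>
      obtain ⟨hx, hy, hne⟩ := mk_mem_pairs.1 he
      exact ⟨mk_mem_pairs.2 ⟨mem_image_of_mem _ hx, mem_image_of_mem _ hy, hginj.ne hne⟩, hk⟩
  rw [this, card_image_of_injective _ (Sym2.map.injective hginj)]
  exact hsq k

/-! ### Lower bound: the Turán colouring -/

lemma exists_three_largest {α : Type} [LinearOrder α] (A : Finset α) (hA : 3 ≤ #A) :
    ∃ v ∈ A, ∃ x ∈ A, ∃ y ∈ A, x ≠ y ∧ v < x ∧ v < y ∧ ∀ w ∈ A, v < w → w = x ∨ w = y := by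
  have h1 : A.Nonempty := card_pos.1 (by omega)
  set x := A.max' h1 with hx
  have hxA : x ∈ A := max'_mem _ _
  have c1 := card_erase_of_mem hxA
  have h2 : (A.erase x).Nonempty := card_pos.1 (by omega)
  set y := (A.erase x).max' h2 with hy
  have hyA : y ∈ A.erase x := max'_mem _ _
  have c2 := card_erase_of_mem hyA
  have h3 : ((A.erase x).erase y).Nonempty := card_pos.1 (by omega)
  have hvA := max'_mem _ h3
  set v := ((A.erase x).erase y).max' h3 with hv
  have hv1 := mem_of_mem_erase hvA
  refine ⟨v, mem_of_mem_erase hv1, x, hxA, y, mem_of_mem_erase hyA, (ne_of_mem_erase hyA).symm,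
    lt_of_le_of_ne (le_max' _ _ (mem_of_mem_erase hv1)) (ne_of_mem_erase hv1),
    lt_of_le_of_ne (le_max' _ _ hv1) (ne_of_mem_erase hvA), fun w hw hvw => ?_⟩
  by_contra! hne
  exact absurd (le_max' _ w (mem_erase.2 ⟨hne.2, mem_erase.2 ⟨hne.1, hw⟩⟩)) (not_le.2 hvw)

/-- The colouring that is rainbow on the Turán graph, and colours every other edge by its smaller
end. -/
noncomputable def turanColor (n r : ℕ) (e : Sym2 (Fin n)) : ℕ :=
  open Classical in
  if e ∈ (SimpleGraph.turanGraph n r).edgeSet then n + Fintype.equivFin (Sym2 (Fin n)) e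
  else (e.inf : Fin n)

lemma turanColor_eq_iff {n r : ℕ} {x y v : Fin n} :
    turanColor n r s(x, y) = v ↔ (x : ℕ) % r = y % r ∧ min x y = v := by
  have hmem : s(x, y) ∈ (SimpleGraph.turanGraph n r).edgeSet ↔ (x : ℕ) % r ≠ y % r := Iff.rfl
  rw [turanColor]
  split_ifs with h <;> rw [hmem] at h
  · have := v.2
    constructor
    · omega
    · exact fun h' => absurd h'.1 h
  · simp only [not_not] at h
    simp [h, Fin.ext_iff]

/-- `turanColor` as an edge labelling. -/
noncomputable def turanLabeling (n r : ℕ) : (⊤ : SimpleGraph (Fin n)).EdgeLabeling ℕ :=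
  fun e => turanColor n r e

/-- Turán edges have colours at least n, so they avoid the vertex colours. Every k < n - r is a
vertex colour because k and k + r lie in the same part. -/
lemma le_numColors_turanLabeling (n r : ℕ) (hr : 0 < r) :
    #(SimpleGraph.turanGraph n r).edgeFinset + (n - r) ≤ numColors (turanLabeling n r) := by
  classical
  set E := (SimpleGraph.turanGraph n r).edgeFinset.image (turanColor n r) with hE
  have hval (e) (he : e ∈ (SimpleGraph.turanGraph n r).edgeFinset) :
      turanColor n r e = n + Fintype.equivFin (Sym2 (Fin n)) e :=
    if_pos (SimpleGraph.mem_edgeFinset.1 he)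
  have hEc : #E = #(SimpleGraph.turanGraph n r).edgeFinset := by
    refine card_image_of_injOn fun e he e' he' h => ?_
    rw [hval e he, hval e' he'] at h
    exact (Fintype.equivFin _).injective (Fin.ext (by omega))
  have hdisj : Disjoint E (range (n - r)) := by
    rw [disjoint_left]
    intro k hk hk'
    obtain ⟨e, he, rfl⟩ := mem_image.1 hk
    rw [hval e he, mem_range] at hk'
    omega
  have hsub : ((E ∪ range (n - r) : Finset ℕ) : Set ℕ) ⊆
      {k : ℕ | ∃ e : (⊤ : SimpleGraph (Fin n)).edgeSet, turanLabeling n r e = k} := by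
    intro k hk
    rcases mem_union.1 hk with hk | hk
    · obtain ⟨e, he, rfl⟩ := mem_image.1 hk
      exact ⟨⟨e, SimpleGraph.edgeSet_mono le_top (SimpleGraph.mem_edgeFinset.1 he)⟩, rfl⟩
    · rw [mem_range] at hk
      let x : Fin n := ⟨k, by omega⟩
      let y : Fin n := ⟨k + r, by omega⟩
      have hxy : x < y := Fin.lt_def.2 (by simp [x, y, hr])
      refine ⟨⟨s(x, y), hxy.ne⟩, (turanColor_eq_iff (v := x)).2 ⟨?_, min_eq_left hxy.le⟩⟩
      exact (Nat.add_mod_right k r).symm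
  have h := Set.ncard_le_ncard hsub (Set.finite_range (turanLabeling n r))
  rwa [Set.ncard_coe_finset, card_union_of_disjoint hdisj, hEc, card_range] at h

lemma not_allClassesIn_turanLabeling {n r p : ℕ} (hr : 0 < r) (hp : r * 2 < p)
    (φ : (K p).Copy (⊤ : SimpleGraph (Fin n))) :
    ¬ AllClassesIn squareFamily ((turanLabeling n r).pullback φ.toHom) := by
  have hinj : Function.Injective φ.toHom := φ.injective'
  rw [allClassesIn_squareFamily_iff]
  set S := univ.image φ.toHom with hSdef
  have hS : #S = p := by rw [hSdef, card_image_of_injective _ hinj, card_univ, Fintype.card_fin]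
  obtain ⟨i, -, hi⟩ := exists_lt_card_fiber_of_mul_lt_card_of_maps_to
    (s := S) (t := range r) (f := fun x => (x : ℕ) % r) (n := 2)
    (fun x _ => mem_range.2 (Nat.mod_lt _ hr)) (by rwa [card_range, hS])
  obtain ⟨v, hv, x, hx, y, hy, hxy, hvx, hvy, hmax⟩ := exists_three_largest _ hi
  simp only [mem_filter] at hv hx hy hmax
  have hcol (a b : Fin n) (hab : a ≠ b) : extendColoring (turanLabeling n r) s(a, b) = v ↔
      (a : ℕ) % r = b % r ∧ min a b = v := by
    rw [← turanColor_eq_iff]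
    exact iff_of_eq (congrArg (· = (v : ℕ))
      (extendColoring_coe (turanLabeling n r) ⟨s(a, b), hab⟩))
  -- In its part, `v` has exactly two larger vertices of the copy, so its colour class is a path
  -- with two edges.
  have hcard : #{e ∈ pairs S | extendColoring (turanLabeling n r) e = v} = 2 := by
    have : {e ∈ pairs S | extendColoring (turanLabeling n r) e = v} = {s(v, x), s(v, y)} := by
      ext e
      induction e using Sym2.ind with
      | _ a b =>
      rw [mem_filter, mk_mem_pairs, mem_insert, mem_singleton]
      constructor
      · rintro ⟨⟨ha, hb, hab⟩, hc⟩
        obtain ⟨hm, hmin⟩ := (hcol a b hab).1 hc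
        rcases lt_or_gt_of_ne hab with h | h
        · rw [min_eq_left h.le] at hmin
          subst hmin
          rcases hmax b ⟨hb, hm.symm.trans hv.2⟩ h with rfl | rfl
          · exact .inl rfl
          · exact .inr rfl
        · rw [min_eq_right h.le] at hmin
          subst hmin
          rcases hmax a ⟨ha, hm.trans hv.2⟩ h with rfl | rfl
          · exact .inl Sym2.eq_swap
          · exact .inr Sym2.eq_swap
      · rintro (h | h)
        · have h1 := (hcol v x hvx.ne).2 ⟨hv.2.trans hx.2.symm, min_eq_left hvx.le⟩
          rw [← mk_mem_pairs, h]
          exact ⟨mk_mem_pairs.2 ⟨hv.1, hx.1, hvx.ne⟩, h1⟩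
        · have h1 := (hcol v y hvy.ne).2 ⟨hv.2.trans hy.2.symm, min_eq_left hvy.le⟩
          rw [← mk_mem_pairs, h]
          exact ⟨mk_mem_pairs.2 ⟨hv.1, hy.1, hvy.ne⟩, h1⟩
    rw [this, card_pair]
    intro h
    rcases Sym2.eq_iff.1 h with ⟨-, h⟩ | ⟨h, -⟩
    · exact hxy h
    · exact hvy.ne h
  intro h
  obtain ⟨m, hm⟩ := h v
  rw [hcard] at hm
  rcases (by omega : m = 0 ∨ m = 1 ∨ 2 ≤ m) with rfl | rfl | h2
  · omega
  · omega
  · have := Nat.mul_le_mul h2 h2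
    omega

lemma extremalNumber_K_eq (n r : ℕ) (hr : 0 < r) :
    SimpleGraph.extremalNumber n (K (r + 1)) = #(SimpleGraph.turanGraph n r).edgeFinset := by
  have : Nontrivial (Fin (r + 1)) := Fin.nontrivial_iff_two_le.2 (by omega)
  convert SimpleGraph.extremalNumber_top (n := n) (α := Fin (r + 1)) using 3; simp

theorem extremalNumber_add_lt_f (n p r : ℕ) (hr : 0 < r) (hp : r * 2 < p) :
    SimpleGraph.extremalNumber n (K (r + 1)) + (n - r) < f n (K p) squareFamily := by
  rw [extremalNumber_K_eq n r hr]
  exact (le_numColors_turanLabeling n r hr).trans_lt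
    (numColors_lt_f _ (not_allClassesIn_turanLabeling hr hp))

/-! ### Asymptotics -/

/-- The edge version of the **Erdős–Stone theorem**. -/
theorem exists_extremalNumber_completeEquipartiteGraph_le {ε : ℝ} (hε : 0 < ε) (r t : ℕ)
    (hr : 0 < r) :
    ∃ c : ℝ, ∀ n : ℕ, (SimpleGraph.extremalNumber n
      (SimpleGraph.completeEquipartiteGraph (r + 1) t) : ℝ) ≤
        c + (1 - 1 / r + ε) * (n * (n + 1) / 2) := by
  classical
  obtain ⟨N, hN⟩ := Filter.eventually_atTop.1
    (SimpleGraph.eventually_completeEquipartiteGraph_isContained_of_minDegree hε r t)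
  set H := SimpleGraph.completeEquipartiteGraph (r + 1) t
  have hr' : (1 : ℝ) / r ≤ 1 := by
    rw [div_le_one (by positivity)]; exact_mod_cast hr
  set d : ℝ := 1 - 1 / r + ε with hd
  have hd0 : 0 ≤ d := by linarith
  -- Deleting a vertex of minimum degree turns the minimum-degree theorem into a recursion; summing
  -- it gives the quadratic bound, with the values up to N absorbed into the constant.
  have step (n : ℕ) (hn : N ≤ n + 1) : (SimpleGraph.extremalNumber (n + 1) H : ℝ) ≤
      SimpleGraph.extremalNumber n H + d * (n + 1) := by
    have hnn : (0 : ℝ) ≤ SimpleGraph.extremalNumber n H + d * (n + 1) := by positivity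
    conv_lhs => rw [← Fintype.card_fin (n + 1)]
    rw [SimpleGraph.extremalNumber_le_iff_of_nonneg H hnn]
    intro G _ hG
    have hmin : (G.minDegree : ℝ) < d * (n + 1) := by
      by_contra! hcon
      exact hG (hN (n + 1) hn (by push_cast; exact hcon))
    obtain ⟨v, hv⟩ := G.exists_minimal_degree_vertex
    have h1 := SimpleGraph.card_edgeFinset_deleteIncidenceSet_le_extremalNumber hG v
    rw [SimpleGraph.card_edgeFinset_deleteIncidenceSet, Fintype.card_fin, Nat.add_sub_cancel,
      ← hv] at h1
    have h2 : #G.edgeFinset ≤ SimpleGraph.extremalNumber n H + G.minDegree := by omega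
    have h3 : (#G.edgeFinset : ℝ) ≤ SimpleGraph.extremalNumber n H + G.minDegree := by
      exact_mod_cast h2
    linarith
  refine ⟨∑ m ∈ range (N + 1), (SimpleGraph.extremalNumber m H : ℝ), fun n => ?_⟩
  have hsmall (n : ℕ) (hn : n ≤ N) : (SimpleGraph.extremalNumber n H : ℝ) ≤
      ∑ m ∈ range (N + 1), (SimpleGraph.extremalNumber m H : ℝ) + d * (n * (n + 1) / 2) := by
    have := single_le_sum (f := fun m => (SimpleGraph.extremalNumber m H : ℝ))
      (fun _ _ => Nat.cast_nonneg _) (mem_range.2 (Nat.lt_succ_of_le hn))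
    have h2 : 0 ≤ d * (n * (n + 1) / 2 : ℝ) := by positivity
    linarith
  induction n with
  | zero => exact hsmall 0 (Nat.zero_le _)
  | succ n ih =>
    rcases le_or_gt (n + 1) N with h | h
    · exact hsmall _ h
    · have := step n h.le
      push_cast
      linarith

/-- Only the leading term matters: the error r² covers the remainder of n modulo r, and 1 covers the
rounded division. -/
lemma le_extremalNumber_K (n r : ℕ) (hr : 0 < r) :
    (1 - 1 / r : ℝ) * n ^ 2 / 2 - (r ^ 2 + 1) ≤ SimpleGraph.extremalNumber n (K (r + 1)) := by
  rw [extremalNumber_K_eq n r hr, SimpleGraph.card_edgeFinset_turanGraph]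
  have hr0 : (0 : ℝ) < r := by exact_mod_cast hr
  have hs : n % r < r := Nat.mod_lt _ hr
  have hsn : n % r ≤ n := Nat.mod_le _ _
  generalize n % r = s at *
  have h1 := Nat.lt_div_mul_add (a := (n ^ 2 - s ^ 2) * (r - 1)) (b := 2 * r) (by omega)
  generalize (n ^ 2 - s ^ 2) * (r - 1) / (2 * r) = D at *
  have h2 : (((n ^ 2 - s ^ 2) * (r - 1) : ℕ) : ℝ) < D * (2 * r) + 2 * r := by exact_mod_cast h1
  rw [Nat.cast_mul, Nat.cast_sub (Nat.pow_le_pow_left hsn 2), Nat.cast_sub hr] at h2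
  push_cast at h2 ⊢
  have h3 : (0 : ℝ) ≤ (s.choose 2 : ℕ) := Nat.cast_nonneg _
  have hsr : (s : ℝ) ≤ r := by exact_mod_cast hs.le
  have hr1 : (1 : ℝ) ≤ r := by exact_mod_cast hr
  have h4 : (1 - 1 / r : ℝ) * n ^ 2 / 2 = n ^ 2 * (r - 1) / (2 * r) := by
    field_simp
  have h5 : (n ^ 2 - s ^ 2 : ℝ) * (r - 1) / (2 * r) < D + 1 := by
    rw [div_lt_iff₀ (by positivity)]; linarith
  have h6 : (s ^ 2 : ℝ) * (r - 1) / (2 * r) ≤ r ^ 2 := by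
    rw [div_le_iff₀ (by positivity)]
    have : (s : ℝ) ^ 2 ≤ r ^ 2 := by gcongr
    nlinarith [sq_nonneg (s : ℝ), sq_nonneg (r : ℝ)]
  have h7 : (n ^ 2 - s ^ 2 : ℝ) * (r - 1) / (2 * r) =
      n ^ 2 * (r - 1) / (2 * r) - s ^ 2 * (r - 1) / (2 * r) := by ring
  rw [h4]
  linarith

theorem isEquivalent_f (p r : ℕ) (hr : 2 ≤ r) (hp : p = 2 * (r + 1) ∨ p = 2 * (r + 1) - 1) :
    Asymptotics.IsEquivalent Filter.atTop (fun n : ℕ => (f n (K p) squareFamily : ℝ))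
      (fun n : ℕ => (SimpleGraph.extremalNumber n (K (r + 1)) : ℝ)) := by
  obtain ⟨t, ht⟩ := exists_f_le_extremalNumber p (r + 1) (by omega) hp
  rw [Asymptotics.IsEquivalent, Asymptotics.isLittleO_iff]
  intro δ hδ
  obtain ⟨c, hc⟩ := exists_extremalNumber_completeEquipartiteGraph_le
    (ε := δ / 8) (by positivity) r t (by omega)
  have hr2 : (1 : ℝ) / r ≤ 1 / 2 := by
    apply one_div_le_one_div_of_le (by norm_num); exact_mod_cast hr
  have hr0 : (0 : ℝ) ≤ 1 / r := by positivity
  set d : ℝ := 1 - 1 / r with hd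
  have hlim : ∀ᶠ n : ℕ in Filter.atTop,
      c + 1 + (1 + δ) * (r ^ 2 + 1) + (1 + δ) * n ≤ δ / 8 * (n : ℝ) ^ 2 := by
    set A := c + 1 + (1 + δ) * (r ^ 2 + 1 : ℝ) with hA
    obtain ⟨M, hM⟩ := exists_nat_ge ((|A| + (1 + δ)) / (δ / 8))
    filter_upwards [Filter.eventually_ge_atTop (max M 1)] with n hn
    have h1 : (1 : ℝ) ≤ n := by exact_mod_cast (le_max_right M 1).trans hn
    have h2 : (M : ℝ) ≤ n := by exact_mod_cast (le_max_left M 1).trans hn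
    have h3 := (div_le_iff₀ (by positivity : (0 : ℝ) < δ / 8)).1 (hM.trans h2)
    have h4 := le_abs_self A
    have h5 := abs_nonneg A
    nlinarith [mul_le_mul_of_nonneg_right h3 (by linarith : (0 : ℝ) ≤ n)]
  filter_upwards [hlim] with n hn
  have hlow := extremalNumber_add_lt_f n p r (by omega) (by omega)
  have hlow' : (SimpleGraph.extremalNumber n (K (r + 1)) : ℝ) ≤ f n (K p) squareFamily := by
    exact_mod_cast (by omega : SimpleGraph.extremalNumber n (K (r + 1)) ≤ f n (K p) squareFamily)
  have hup : (f n (K p) squareFamily : ℝ) ≤ SimpleGraph.extremalNumber n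
      (SimpleGraph.completeEquipartiteGraph (r + 1) t) + 1 := by exact_mod_cast ht n
  have hup' := hc n
  have hex := le_extremalNumber_K n r (by omega)
  rw [← hd] at hex
  have hn0 : (0 : ℝ) ≤ n := Nat.cast_nonneg n
  rw [Pi.sub_apply, Real.norm_of_nonneg (by linarith), Real.norm_of_nonneg (by positivity)]
  have h1 : (1 + δ) * (d * n ^ 2 / 2 - (r ^ 2 + 1)) ≤
      (1 + δ) * SimpleGraph.extremalNumber n (K (r + 1)) := by gcongr
  have hd1 : d * n ≤ n := by nlinarith
  -- Since r ≥ 2, the Turán density is at least 1/2, so the slack δ d n² / 2 is at least δ n² / 4.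
  -- It absorbs the δ n² / 16 from Erdős–Stone and the δ n² / 8 that bounds the lower-order terms.
  have hd2 : 1 / 2 * (n : ℝ) ^ 2 ≤ d * n ^ 2 := by
    apply mul_le_mul_of_nonneg_right _ (sq_nonneg _); linarith
  nlinarith [mul_le_mul_of_nonneg_left hd2 hδ.le, mul_nonneg hδ.le hn0]

theorem theoremt (p : ℕ) (hp : 5 ≤ p) :
    Asymptotics.IsEquivalent Filter.atTop
      (fun n : ℕ => (RainbowF.f n (RainbowF.K p) RainbowF.squareFamily : ℝ))
      (fun n : ℕ => (SimpleGraph.extremalNumber n (RainbowF.K (p ⌈/⌉ 2)) : ℝ)) ∧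
    ∀ n : ℕ, p ≤ n →
      (SimpleGraph.extremalNumber n (RainbowF.K (p ⌈/⌉ 2)) : ℤ) + n - (p ⌈/⌉ 2 : ℕ) + 2
        ≤ (RainbowF.f n (RainbowF.K p) RainbowF.squareFamily : ℤ) := by
  obtain ⟨r, hr, hq⟩ : ∃ r, 2 ≤ r ∧ p ⌈/⌉ 2 = r + 1 ∧
      (p = 2 * (r + 1) ∨ p = 2 * (r + 1) - 1) := by
    refine ⟨(p - 1) / 2, by omega, ?_, by omega⟩
    rw [Nat.ceilDiv_eq_add_pred_div]
    omega
  rw [hq.1]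
  refine ⟨isEquivalent_f p r hr hq.2, fun n hn => ?_⟩
  have := extremalNumber_add_lt_f n p r (by omega) (by omega)
  omega
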